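/- Let $G$ be a compact (Hausdorff, finite-dimensional, real) Lie group and $H\subseteq G$ a closed subgroup; integrals over $G$ and $H$ are with respect to the normalized Haar measures, and $G/H$ carries its $G$-invariant probability measure (the image of the Haar measure of $G$). For $f\in C^\infty(G)$ (complex-valued) the Radon transform is $$\mathcal R f(x,y)=\int_H f(xhy^{-1})\,dh ,\qquad x,y\in G;$$ it is invariant under $x\mapsto xk$ and $y\mapsto yl$ for $k,l\in H$, hence is a function on $G/H\times G/H$. Let $\widehat G$ be the set of equivalence classes of continuous irreducible unitary representations $\pi: G\to U(d_\pi)$; choose any one representative $\pi$ in each class and put $$\widehat f(\pi)=\int_G f(g)\,\pi(g)^*\,dg,\qquad \pi_H=\int_H\pi(h)\,dh,\qquad \|M\|_{HS}^2=\operatorname{trace}(M^*M).$$ Let $\widehat G_1\subseteq\widehat G$ be the set of class-1 representations with respect to $H$, that is, those with $\operatorname{rank}(\pi_H)\ge 1$. Then $\mathcal R f\in L^2(G/H\times G/H)$, and $$\|\mathcal R f\|^2_{L^2(G/H\times G/H)}=\sum_{\pi\in\widehat G_1}\operatorname{rank}(\pi_H)\,\|\widehat f(\pi)\|_{HS}^2,$$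 where the series on the right converges (unconditionally) to the left-hand side. -/

import Mathlib

open MeasureTheory
open scoped Manifold ContDiff

namespace CompactRadon

noncomputable section

/-! ### Normalized Haar measures -/

/-- The normalized (total mass one) Haar measure on a compact group. -/
def normalizedHaar (K : Type*) [Group K] [TopologicalSpace K] [IsTopologicalGroup K]
    [CompactSpace K] [MeasurableSpace K] [BorelSpace K] : Measure K :=
  Measure.haarMeasure (⊤ : TopologicalSpace.PositiveCompacts K)

section Haar

variable {K : Type*} [Group K] [TopologicalSpace K] [IsTopologicalGroup K]
  [CompactSpace K] [MeasurableSpace K] [BorelSpace K]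

instance : (normalizedHaar K).IsHaarMeasure := by
  unfold normalizedHaar; infer_instance

instance : IsProbabilityMeasure (normalizedHaar K) :=
  ⟨Measure.haarMeasure_self (K₀ := (⊤ : TopologicalSpace.PositiveCompacts K))⟩

instance : (normalizedHaar K).IsMulRightInvariant := by
  constructor
  intro g
  have : IsProbabilityMeasure (Measure.map (· * g) (normalizedHaar K)) :=
    Measure.isProbabilityMeasure_map (measurable_mul_const g).aemeasurable
  have : (Measure.map (· * g) (normalizedHaar K)).IsHaarMeasure := inferInstance
  exact Measure.isHaarMeasure_eq_of_isProbabilityMeasure _ _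

end Haar

/-- A closed subgroup of a compact group is compact. -/
instance compactSpace_of_isClosed {G : Type*} [Group G] [TopologicalSpace G] [CompactSpace G]
    (H : Subgroup G) [hH : IsClosed (H : Set G)] : CompactSpace H :=
  isCompact_iff_compactSpace.mp hH.isCompact

instance borelSpace_subgroup {G : Type*} [Group G] [TopologicalSpace G] [MeasurableSpace G]
    [BorelSpace G] (H : Subgroup G) : BorelSpace H :=
  Subtype.borelSpace (H : Set G)

/-! ### Irreducible unitary representations and the unitary dual -/

/-- The linear representation on `ℂ^d` given by a homomorphism into the unitary matrices. -/
def matrixRep {G : Type*} [Group G] {d : ℕ} (π : G →* Matrix.unitaryGroup (Fin d) ℂ) :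
    Representation ℂ G (Fin d → ℂ) where
  toFun g := Matrix.toLin' (π g : Matrix (Fin d) (Fin d) ℂ)
  map_one' := by
    rw [map_one]
    exact Matrix.toLin'_one
  map_mul' g h := by
    rw [map_mul]
    exact Matrix.toLin'_mul _ _

/-- A continuous irreducible unitary matrix representation of `G` (its dimension is positive, since
an irreducible representation is nonzero). -/
structure UnitaryIrrep (G : Type*) [Group G] [TopologicalSpace G] where
  dim : ℕ
  toHom : G →* Matrix.unitaryGroup (Fin dim) ℂ
  continuous_toHom : Continuous toHom
  irreducible : (matrixRep toHom).IsIrreducible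

namespace UnitaryIrrep

variable {G : Type*} [Group G] [TopologicalSpace G]

/-- The matrix `π(g)`. -/
def mat (π : UnitaryIrrep G) (g : G) : Matrix (Fin π.dim) (Fin π.dim) ℂ := (π.toHom g).1

/-- Equivalence of representations: there is an invertible matrix `M` with
`π₁(g) M = M π₂(g)` for all `g`. -/
def Equivalent (π₁ π₂ : UnitaryIrrep G) : Prop :=
  ∃ (M : Matrix (Fin π₁.dim) (Fin π₂.dim) ℂ) (N : Matrix (Fin π₂.dim) (Fin π₁.dim) ℂ),
    M * N = 1 ∧ N * M = 1 ∧ ∀ g, π₁.mat g * M = M * π₂.mat g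

theorem equivalent_equivalence : Equivalence (Equivalent (G := G)) where
  refl π := ⟨1, 1, by simp, by simp, fun g => by simp⟩
  symm := by
    rintro π₁ π₂ ⟨M, N, h1, h2, h⟩
    refine ⟨N, M, h2, h1, fun g => ?_⟩
    calc π₂.mat g * N = (N * M) * π₂.mat g * N := by rw [h2, Matrix.one_mul]
      _ = N * (M * π₂.mat g) * N := by simp only [Matrix.mul_assoc]
      _ = N * (π₁.mat g * M) * N := by rw [h]
      _ = N * π₁.mat g * (M * N) := by simp only [Matrix.mul_assoc]
      _ = N * π₁.mat g := by rw [h1, Matrix.mul_one]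
  trans := by
    rintro π₁ π₂ π₃ ⟨M, N, h1, h2, h⟩ ⟨M', N', h1', h2', h'⟩
    refine ⟨M * M', N' * N, ?_, ?_, fun g => ?_⟩
    · rw [Matrix.mul_assoc, ← Matrix.mul_assoc M', h1', Matrix.one_mul, h1]
    · rw [Matrix.mul_assoc, ← Matrix.mul_assoc N, h2, Matrix.one_mul, h2']
    · rw [← Matrix.mul_assoc, h, Matrix.mul_assoc, h', Matrix.mul_assoc]

instance setoid (G : Type*) [Group G] [TopologicalSpace G] : Setoid (UnitaryIrrep G) where
  r := Equivalent
  iseqv := equivalent_equivalence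

end UnitaryIrrep

/-- The unitary dual `Ĝ`: equivalence classes of irreducible unitary representations. -/
def UnitaryDual (G : Type*) [Group G] [TopologicalSpace G] : Type _ :=
  Quotient (UnitaryIrrep.setoid G)

/-- The class in `Ĝ` of an irreducible unitary representation. -/
def UnitaryIrrep.toDual {G : Type*} [Group G] [TopologicalSpace G] (π : UnitaryIrrep G) :
    UnitaryDual G :=
  Quotient.mk (UnitaryIrrep.setoid G) π

/-! ### Fourier coefficients, Radon transform -/

section

variable {G : Type*} [Group G] [TopologicalSpace G] [IsTopologicalGroup G] [CompactSpace G]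
  [MeasurableSpace G] [BorelSpace G]

/-- The matrix-valued Fourier coefficient `f̂(π) = ∫_G f(g) π(g)^* dg` (entrywise integral). -/
def groupFourierCoeff (f : G → ℂ) (π : UnitaryIrrep G) : Matrix (Fin π.dim) (Fin π.dim) ℂ :=
  Matrix.of fun i j => ∫ g, f g * (π.mat g).conjTranspose i j ∂(normalizedHaar G)

/-- The squared Hilbert-Schmidt norm `trace (M^* M)`. -/
def hsNormSq {d : ℕ} (M : Matrix (Fin d) (Fin d) ℂ) : ℝ :=
  (M.conjTranspose * M).trace.re

variable (H : Subgroup G) [hH : IsClosed (H : Set G)]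

/-- The averaged projection `π_H = ∫_H π(h) dh` (entrywise integral). -/
def avgProj (π : UnitaryIrrep G) : Matrix (Fin π.dim) (Fin π.dim) ℂ :=
  Matrix.of fun i j => ∫ h : H, π.mat (h : G) i j ∂(normalizedHaar H)

/-- `Ĝ₁ ⊆ Ĝ`: the classes of the class-1 representations with respect to `H`, i.e. of those `π`
with `rank π_H ≥ 1`. -/
def classOneDual : Set (UnitaryDual G) :=
  {c | ∃ π : UnitaryIrrep G, π.toDual = c ∧ 1 ≤ (avgProj H π).rank}

/-- The Radon transform as a function on `G × G`: `Rf(x, y) = ∫_H f(x h y⁻¹) dh`. -/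
def radonPre (f : G → ℂ) (x y : G) : ℂ :=
  ∫ h : H, f (x * (h : G) * y⁻¹) ∂(normalizedHaar H)

theorem radonPre_mul_mul (f : G → ℂ) (x y : G) (k l : H) :
    radonPre H f (x * k) (y * l) = radonPre H f x y := by
  have h1 := integral_mul_left_eq_self (μ := normalizedHaar H)
    (fun h : H => f (x * (h : G) * (l : G)⁻¹ * y⁻¹)) k
  have h2 := integral_mul_right_eq_self (μ := normalizedHaar H)
    (fun h : H => f (x * (h : G) * y⁻¹)) l⁻¹
  unfold radonPre
  rw [← h2]
  simp only [Subgroup.coe_mul, Subgroup.coe_inv, mul_inv_rev, mul_assoc] at h1 ⊢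
  exact h1

/-- The Radon transform as a function on `G/H × G/H`. -/
def radon (f : G → ℂ) (p : (G ⧸ H) × (G ⧸ H)) : ℂ :=
  Quotient.liftOn₂' p.1 p.2 (radonPre H f) (by
    intro a₁ a₂ b₁ b₂ h₁ h₂
    rw [QuotientGroup.leftRel_apply] at h₁ h₂
    have := radonPre_mul_mul H f a₁ a₂ ⟨_, h₁⟩ ⟨_, h₂⟩
    simpa using this.symm)

theorem radon_mk (f : G → ℂ) (x y : G) :
    radon H f (QuotientGroup.mk x, QuotientGroup.mk y) = radonPre H f x y := rfl

end

/-- The `G`-invariant probability measure on the homogeneous space `G/H`: the image of the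
normalized Haar measure of `G` under the quotient map. -/
def quotientHaar {G : Type*} [Group G] [TopologicalSpace G] [IsTopologicalGroup G]
    [CompactSpace G] [MeasurableSpace G] [BorelSpace G] (H : Subgroup G) : Measure (G ⧸ H) :=
  Measure.map (QuotientGroup.mk : G → G ⧸ H) (normalizedHaar G)

end

end CompactRadon

/-! For fixed y, invariance of Haar measure shows that x ↦ Rf(x, y) has Fourier coefficient π_H
π(y)^* f̂(π) (`groupFourierCoeff_radonPre`). Plancherel in x then gives ∫ |Rf(x, y)|² dx = ∑ d_π
‖π_H π(y)^* f̂(π)‖². Now integrate over y. Since π_H is an orthogonal projection, Schur's lemma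
makes ∫ π(y) π_H π(y)^* dy the scalar tr(π_H)/d_π = rank(π_H)/d_π; the dimension cancels and
rank(π_H) ‖f̂(π)‖² remains (`integral_hsNormSq_avgProj_mul`). Classes outside Ĝ₁ contribute zero.

Plancherel (`hasSum_plancherel`) is Parseval for the functions √d_π π_ij. Their orthonormality is
Schur's lemma; their completeness is Peter-Weyl (`coeffSpan_orthogonal_eq_bot`). Convolution by a
Hermitian kernel is a compact self-adjoint operator commuting with right translations, so its
eigenspaces for nonzero eigenvalues are finite-dimensional invariant spaces of continuous functions,
and such spaces are spanned by matrix coefficients. A function orthogonal to all coefficients is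
therefore killed by every such convolution, hence is zero. -/

namespace CompactRadon

noncomputable section

open scoped InnerProductSpace

/-! ### Entrywise integrals of matrix-valued functions -/

/-- The entrywise integral of a matrix-valued function. -/
def matInt {K : Type*} [MeasurableSpace K] (μ : Measure K) {m n : Type*}
    (F : K → Matrix m n ℂ) : Matrix m n ℂ :=
  Matrix.of fun i j => ∫ k, F k i j ∂μ

theorem conjTranspose_matInt {K : Type*} [MeasurableSpace K] {μ : Measure K} {m n : Type*}
    (F : K → Matrix m n ℂ) :
    (matInt μ F).conjTranspose = matInt μ fun k => (F k).conjTranspose := by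
  ext i j
  simp only [matInt, Matrix.conjTranspose_apply, Matrix.of_apply]
  exact integral_conj.symm

theorem matInt_const {K : Type*} [MeasurableSpace K] {μ : Measure K} [IsProbabilityMeasure μ]
    {m n : Type*} (A : Matrix m n ℂ) : matInt μ (fun _ : K => A) = A := by
  ext i j
  simp [matInt]

section Invariant

variable {K : Type*} [TopologicalSpace K] [MeasurableSpace K] [BorelSpace K]
  {μ : Measure K} {m n : Type*} [Group K] [IsTopologicalGroup K]

theorem matInt_mul_left_eq_self [μ.IsMulLeftInvariant] (F : K → Matrix m n ℂ) (g : K) :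
    (matInt μ fun k => F (g * k)) = matInt μ F := by
  ext i j
  exact integral_mul_left_eq_self (fun k => F k i j) g

theorem matInt_mul_right_eq_self [μ.IsMulRightInvariant] (F : K → Matrix m n ℂ) (g : K) :
    (matInt μ fun k => F (k * g)) = matInt μ F := by
  ext i j
  exact integral_mul_right_eq_self (fun k => F k i j) g

end Invariant

section MatInt

variable {K : Type*} [TopologicalSpace K] [CompactSpace K] [MeasurableSpace K] [BorelSpace K]
  {μ : Measure K} [IsFiniteMeasure μ] {l m n : Type*}

theorem integrable_of_continuous {E : Type*} [NormedAddCommGroup E]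
    [SecondCountableTopologyEither K E] {f : K → E} (hf : Continuous f) : Integrable f μ :=
  hf.integrable_of_hasCompactSupport (HasCompactSupport.of_compactSpace f)

theorem mul_matInt [Fintype m] (A : Matrix l m ℂ) {F : K → Matrix m n ℂ} (hF : Continuous F) :
    A * matInt μ F = matInt μ fun k => A * F k := by
  ext i j
  simp only [matInt, Matrix.mul_apply, Matrix.of_apply]
  rw [integral_finsetSum _ fun x _ => (integrable_of_continuous (hF.matrix_elem x j)).const_mul _]
  simp only [integral_const_mul]

theorem matInt_mul [Fintype m] {F : K → Matrix l m ℂ} (hF : Continuous F) (A : Matrix m n ℂ) :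
    matInt μ F * A = matInt μ fun k => F k * A := by
  ext i j
  simp only [matInt, Matrix.mul_apply, Matrix.of_apply]
  rw [integral_finsetSum _ fun x _ => (integrable_of_continuous (hF.matrix_elem i x)).mul_const _]
  simp only [integral_mul_const]

theorem trace_matInt [Fintype m] {F : K → Matrix m m ℂ} (hF : Continuous F) :
    (matInt μ F).trace = ∫ k, (F k).trace ∂μ := by
  simp only [Matrix.trace, Matrix.diag_apply, matInt, Matrix.of_apply]
  rw [integral_finsetSum _ fun x _ => integrable_of_continuous (hF.matrix_elem x x)]

end MatInt

/-! ### Hilbert-Schmidt norm -/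

theorem ofReal_hsNormSq {d : ℕ} (A : Matrix (Fin d) (Fin d) ℂ) :
    (hsNormSq A : ℂ) = (A.conjTranspose * A).trace := by
  have h : star (A.conjTranspose * A).trace = (A.conjTranspose * A).trace := by
    rw [← Matrix.trace_conjTranspose, Matrix.conjTranspose_mul, Matrix.conjTranspose_conjTranspose]
  exact Complex.conj_eq_iff_re.mp h

theorem hsNormSq_eq_sum {d : ℕ} (A : Matrix (Fin d) (Fin d) ℂ) :
    hsNormSq A = ∑ i, ∑ j, ‖A i j‖ ^ 2 := by
  rw [← Complex.ofReal_inj, ofReal_hsNormSq, Matrix.trace, Finset.sum_comm]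
  push_cast
  refine Finset.sum_congr rfl fun i _ => ?_
  rw [Matrix.diag_apply, Matrix.mul_apply]
  refine Finset.sum_congr rfl fun j _ => ?_
  rw [Matrix.conjTranspose_apply]
  exact Complex.conj_mul' _

theorem hsNormSq_nonneg {d : ℕ} (A : Matrix (Fin d) (Fin d) ℂ) : 0 ≤ hsNormSq A := by
  rw [hsNormSq_eq_sum]
  positivity

/-- The rank of an idempotent matrix is its trace. -/
theorem trace_eq_rank_of_mul_self {d : ℕ} {P : Matrix (Fin d) (Fin d) ℂ} (hP : P * P = P) :
    P.trace = P.rank := by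
  have h : IsIdempotentElem (Matrix.toLin' P) := by
    rw [IsIdempotentElem, Module.End.mul_eq_comp, ← Matrix.toLin'_mul, hP]
  rw [← Matrix.trace_toLin'_eq, (LinearMap.IsIdempotentElem.isProj_range _ h).trace]
  rfl

/-! ### Schur's lemma and the orthogonality relations -/

namespace UnitaryIrrep

variable {G : Type*} [Group G] [TopologicalSpace G]

section Basic

variable (π : UnitaryIrrep G)

theorem mat_one : π.mat 1 = 1 := by
  simp [mat]

theorem mat_mul (g h : G) : π.mat (g * h) = π.mat g * π.mat h := by
  simp [mat]

theorem conjTranspose_mat_mul_self (g : G) : (π.mat g).conjTranspose * π.mat g = 1 :=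
  Matrix.UnitaryGroup.star_mul_self _

theorem mat_mul_conjTranspose_self (g : G) : π.mat g * (π.mat g).conjTranspose = 1 :=
  (π.toHom g).2.2

theorem mat_inv (g : G) : π.mat g⁻¹ = (π.mat g).conjTranspose := by
  have h : π.mat g⁻¹ * π.mat g = 1 := by rw [← mat_mul, inv_mul_cancel, mat_one]
  calc π.mat g⁻¹ = π.mat g⁻¹ * (π.mat g * (π.mat g).conjTranspose) := by
        rw [mat_mul_conjTranspose_self, Matrix.mul_one]
    _ = (π.mat g).conjTranspose := by rw [← Matrix.mul_assoc, h, Matrix.one_mul]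

theorem continuous_mat : Continuous π.mat :=
  continuous_subtype_val.comp π.continuous_toHom

theorem dim_pos : 0 < π.dim := by
  rcases Nat.eq_zero_or_pos π.dim with h | h
  · exfalso
    have := π.irreducible
    have : IsEmpty (Fin π.dim) := by rw [h]; infer_instance
    refine bot_ne_top (α := Subrepresentation (matrixRep π.toHom)) ?_
    ext v
    simp [Subsingleton.elim v 0]
  · exact h

end Basic

variable {π ρ : UnitaryIrrep G}

/-- The intertwining map given by an intertwining matrix. -/
def intertwiningMap (A : Matrix (Fin π.dim) (Fin ρ.dim) ℂ)
    (hA : ∀ g, π.mat g * A = A * ρ.mat g) :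
    Representation.IntertwiningMap (matrixRep ρ.toHom) (matrixRep π.toHom) where
  toLinearMap := Matrix.toLin' A
  isIntertwining' g := by
    change Matrix.toLin' A ∘ₗ Matrix.toLin' (ρ.mat g) = Matrix.toLin' (π.mat g) ∘ₗ Matrix.toLin' A
    rw [← Matrix.toLin'_mul, ← Matrix.toLin'_mul, hA]

/-- Schur's lemma: a nonzero intertwiner of irreducibles is bijective, and its inverse then provides
the equivalence. -/
theorem eq_zero_of_not_equivalent (A : Matrix (Fin π.dim) (Fin ρ.dim) ℂ)
    (hA : ∀ g, π.mat g * A = A * ρ.mat g) (h : ¬ Equivalent π ρ) : A = 0 := by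
  have := π.irreducible
  have := ρ.irreducible
  rcases Representation.IsIrreducible.bijective_or_eq_zero (intertwiningMap A hA) with hb | h0
  · refine absurd ?_ h
    let e := LinearEquiv.ofBijective (Matrix.toLin' A) hb
    refine ⟨A, LinearMap.toMatrix' e.symm.toLinearMap, ?_, ?_, hA⟩
    · apply Matrix.toLin'.injective
      rw [Matrix.toLin'_mul, Matrix.toLin'_toMatrix', Matrix.toLin'_one]
      exact LinearMap.ext fun v => e.apply_symm_apply v
    · apply Matrix.toLin'.injective
      rw [Matrix.toLin'_mul, Matrix.toLin'_toMatrix', Matrix.toLin'_one]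
      exact LinearMap.ext fun v => e.symm_apply_apply v
  · apply Matrix.toLin'.injective
    rw [map_zero]
    exact congrArg Representation.IntertwiningMap.toLinearMap h0

theorem exists_eq_smul_one (A : Matrix (Fin π.dim) (Fin π.dim) ℂ)
    (hA : ∀ g, π.mat g * A = A * π.mat g) : ∃ c : ℂ, A = c • 1 := by
  have := π.irreducible
  obtain ⟨c, hc⟩ :=
    (Representation.IsIrreducible.algebraMap_intertwiningMap_bijective_of_isAlgClosed
      (ρ := matrixRep π.toHom)).2 (intertwiningMap A hA)
  refine ⟨c, ?_⟩
  apply Matrix.toLin'.injective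
  rw [map_smul, Matrix.toLin'_one]
  exact (congrArg Representation.IntertwiningMap.toLinearMap hc).symm

theorem eq_trace_smul_one (A : Matrix (Fin π.dim) (Fin π.dim) ℂ)
    (hA : ∀ g, π.mat g * A = A * π.mat g) : A = (A.trace / π.dim) • 1 := by
  obtain ⟨c, rfl⟩ := exists_eq_smul_one A hA
  have : (π.dim : ℂ) ≠ 0 := Nat.cast_ne_zero.mpr π.dim_pos.ne'
  simp [Matrix.trace_smul, this]

/-- Averaging a matrix unit turns Schur's lemma into a statement about integrals of products of
matrix coefficients. -/
theorem mul_single_mul_conjTranspose_apply (π ρ : UnitaryIrrep G) (g : G) (i j : Fin π.dim)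
    (k l : Fin ρ.dim) :
    (π.mat g * Matrix.single j l (1 : ℂ) * (ρ.mat g).conjTranspose) i k =
      π.mat g i j * star (ρ.mat g k l) := by
  simp [Matrix.mul_apply, Matrix.single_apply, ite_and, Finset.sum_ite_eq]

variable [IsTopologicalGroup G] [CompactSpace G] [MeasurableSpace G] [BorelSpace G]

/-- The average `∫ π(g) M ρ(g)^* dg` intertwines. -/
theorem mat_mul_average (π ρ : UnitaryIrrep G) (M : Matrix (Fin π.dim) (Fin ρ.dim) ℂ) (h : G) :
    π.mat h * matInt (normalizedHaar G) (fun g => π.mat g * M * (ρ.mat g).conjTranspose) =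
      matInt (normalizedHaar G) (fun g => π.mat g * M * (ρ.mat g).conjTranspose) * ρ.mat h := by
  have hπ := π.continuous_mat
  have hρ := ρ.continuous_mat
  have hc : Continuous fun g => π.mat g * M * (ρ.mat g).conjTranspose := by fun_prop
  -- Substitute g ↦ hg on the right only; ρ(hg)^* ρ(h) = ρ(g)^* then absorbs the factor.
  conv_rhs => rw [← matInt_mul_left_eq_self _ h]
  rw [mul_matInt _ hc, matInt_mul (by fun_prop)]
  congr 1
  funext g
  simp only [mat_mul, Matrix.conjTranspose_mul, Matrix.mul_assoc, conjTranspose_mat_mul_self,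
    Matrix.mul_one]

theorem average_eq_zero (h : ¬ Equivalent π ρ) (M : Matrix (Fin π.dim) (Fin ρ.dim) ℂ) :
    matInt (normalizedHaar G) (fun g => π.mat g * M * (ρ.mat g).conjTranspose) = 0 :=
  eq_zero_of_not_equivalent _ (mat_mul_average π ρ M) h

/-- The average commutes with π, so it is scalar, and conjugation preserves the trace. Used with M a
matrix unit for orthogonality and with M = π_H for the integral over y. -/
theorem average_eq_smul_one (π : UnitaryIrrep G) (M : Matrix (Fin π.dim) (Fin π.dim) ℂ) :
    matInt (normalizedHaar G) (fun g => π.mat g * M * (π.mat g).conjTranspose) =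
      (M.trace / π.dim) • 1 := by
  have hπ := π.continuous_mat
  rw [eq_trace_smul_one _ (mat_mul_average π π M), trace_matInt (by fun_prop)]
  simp [Matrix.trace_mul_cycle, conjTranspose_mat_mul_self]

theorem integral_mul_star_eq_zero (h : ¬ Equivalent π ρ) (i j : Fin π.dim) (k l : Fin ρ.dim) :
    ∫ g, π.mat g i j * star (ρ.mat g k l) ∂(normalizedHaar G) = 0 := by
  have := congrFun (congrFun (average_eq_zero h (Matrix.single j l 1)) i) k
  simp only [matInt, Matrix.of_apply, mul_single_mul_conjTranspose_apply] at this
  exact this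

theorem integral_mul_star_self (π : UnitaryIrrep G) (i j k l : Fin π.dim) :
    ∫ g, π.mat g i j * star (π.mat g k l) ∂(normalizedHaar G) =
      if i = k ∧ j = l then (π.dim : ℂ)⁻¹ else 0 := by
  have := congrFun (congrFun (average_eq_smul_one π (Matrix.single j l 1)) i) k
  simp only [matInt, Matrix.of_apply, mul_single_mul_conjTranspose_apply] at this
  rw [this, Matrix.smul_apply, Matrix.one_apply]
  by_cases hik : i = k <;> by_cases hjl : j = l
  · subst hik hjl; simp
  · simp [hik, hjl]
  · simp [hik]
  · simp [hik]

end UnitaryIrrep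

/-! ### Integral operators with continuous kernels -/

section KernelOperator

variable {X : Type*} [TopologicalSpace X] [CompactSpace X]
  {V : Type*} [NormedAddCommGroup V] [InnerProductSpace ℂ V]

/-- The operator `v ↦ (x ↦ ⟪K x, v⟫)` given by a continuous family of vectors. -/
def kernelOp (K : C(X, V)) : V →L[ℂ] C(X, ℂ) :=
  LinearMap.mkContinuous
    { toFun := fun v => ⟨fun x => ⟪K x, v⟫_ℂ, K.continuous.inner continuous_const⟩
      map_add' := fun v w => by ext x; exact inner_add_right _ _ _
      map_smul' := fun c v => by ext x; exact inner_smul_right _ _ _ }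
    ‖K‖ fun v => (ContinuousMap.norm_le _ (by positivity)).mpr fun x =>
      (norm_inner_le_norm _ _).trans
        (mul_le_mul_of_nonneg_right (K.norm_coe_le_norm x) (norm_nonneg v))

/-- By the Arzela-Ascoli theorem, a kernel operator is compact. -/
theorem isCompactOperator_kernelOp (K : C(X, V)) : IsCompactOperator (kernelOp K) := by
  let e := ContinuousMap.linearIsometryBoundedOfCompact X ℂ ℂ
  have hA : IsCompact (closure (e.toHomeomorph '' (kernelOp K '' Metric.closedBall 0 1))) := by
    refine BoundedContinuousFunction.arzela_ascoli (Metric.closedBall 0 ‖K‖)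
      (isCompact_closedBall _ _) _ ?_ ?_
    · rintro _ x ⟨_, ⟨v, hv, rfl⟩, rfl⟩
      rw [mem_closedBall_zero_iff] at hv ⊢
      calc ‖⟪K x, v⟫_ℂ‖ ≤ ‖K x‖ * ‖v‖ := norm_inner_le_norm _ _
        _ ≤ ‖K‖ * 1 := mul_le_mul (K.norm_coe_le_norm x) hv (norm_nonneg _) (norm_nonneg _)
        _ = ‖K‖ := mul_one _
    -- Equicontinuity: the modulus of continuity of K serves all v in the unit ball at once.
    · intro x₀
      refine Metric.equicontinuousAt_iff_right.mpr fun ε hε => ?_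
      filter_upwards [Metric.continuousAt_iff'.mp K.continuous.continuousAt ε hε] with x hx
      rintro ⟨_, ⟨_, ⟨v, hv, rfl⟩, rfl⟩⟩
      rw [mem_closedBall_zero_iff] at hv
      change dist ⟪K x₀, v⟫_ℂ ⟪K x, v⟫_ℂ < ε
      rw [dist_eq_norm, ← inner_sub_left]
      calc ‖⟪K x₀ - K x, v⟫_ℂ‖ ≤ ‖K x₀ - K x‖ * ‖v‖ := norm_inner_le_norm _ _
        _ ≤ ‖K x₀ - K x‖ * 1 := by gcongr
        _ < ε := by rwa [mul_one, ← dist_eq_norm, dist_comm]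
  rw [← e.toHomeomorph.image_closure] at hA
  refine ⟨_, e.toHomeomorph.isCompact_image.mp hA,
    Filter.mem_of_superset (Metric.closedBall_mem_nhds 0 one_pos) fun v hv => ?_⟩
  exact subset_closure (Set.mem_image_of_mem _ hv)

end KernelOperator

/-! ### Right translations -/

section Translation

variable {G : Type*} [Group G] [TopologicalSpace G] [IsTopologicalGroup G]

/-- Right translation of continuous functions. -/
def rightTranslate (g : G) : C(G, ℂ) →ₗ[ℂ] C(G, ℂ) where
  toFun f := ⟨fun x => f (x * g), by fun_prop⟩
  map_add' _ _ := rfl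
  map_smul' _ _ := rfl

theorem rightTranslate_apply (g : G) (f : C(G, ℂ)) (x : G) : rightTranslate g f x = f (x * g) := rfl

theorem rightTranslate_one (f : C(G, ℂ)) : rightTranslate 1 f = f := by
  ext x; simp [rightTranslate_apply]

theorem rightTranslate_mul (g h : G) (f : C(G, ℂ)) :
    rightTranslate (g * h) f = rightTranslate g (rightTranslate h f) := by
  ext x; simp [rightTranslate_apply, mul_assoc]

theorem continuous_rightTranslate [CompactSpace G] (f : C(G, ℂ)) : Continuous fun g : G => rightTranslate g f := by
  let F : C(G × G, ℂ) := ⟨fun p => f (p.2 * p.1), by fun_prop⟩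
  exact F.curry.continuous

end Translation

/-! ### The Hilbert space `L²(G)` and convolution operators -/

section L2

variable {G : Type*} [Group G] [TopologicalSpace G] [IsTopologicalGroup G] [CompactSpace G]
  [MeasurableSpace G] [BorelSpace G]

instance : (normalizedHaar G).Regular := by
  unfold normalizedHaar; infer_instance

variable (G) in
/-- The Hilbert space of square-integrable functions. -/
abbrev L2 : Type _ := Lp ℂ 2 (normalizedHaar G)

/-- The class in `L²(G)` of a continuous function. -/
def toL2 : C(G, ℂ) →L[ℂ] L2 G := ContinuousMap.toLp 2 (normalizedHaar G) ℂ

theorem inner_toL2 (f g : C(G, ℂ)) :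
    ⟪toL2 f, toL2 g⟫_ℂ = ∫ x, g x * star (f x) ∂(normalizedHaar G) :=
  ContinuousMap.inner_toLp _ f g

theorem toL2_injective : Function.Injective (toL2 : C(G, ℂ) → L2 G) :=
  ContinuousMap.toLp_injective _

theorem denseRange_toL2 [T2Space G] : DenseRange (toL2 : C(G, ℂ) → L2 G) :=
  ContinuousMap.toLp_denseRange ℂ _ ℂ (by simp)

theorem inner_rightTranslate (g : G) (u v : C(G, ℂ)) :
    ⟪toL2 (rightTranslate g u), toL2 (rightTranslate g v)⟫_ℂ = ⟪toL2 u, toL2 v⟫_ℂ := by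
  rw [inner_toL2, inner_toL2]
  exact integral_mul_right_eq_self (fun x => v x * star (u x)) g

/-- The family `x ↦ (y ↦ conj k(x y⁻¹))` in `L²(G)`. -/
def convKernel (k : C(G, ℂ)) : C(G, L2 G) :=
  -- The conjugate cancels the one in the first slot of the inner product.
  let F : C(G × G, ℂ) := ⟨fun p => star (k (p.1 * p.2⁻¹)), by fun_prop⟩
  ⟨fun x => toL2 (F.curry x), toL2.continuous.comp F.curry.continuous⟩

/-- Left convolution `f ↦ k * f` from `L²(G)` to continuous functions. -/
def conv (k : C(G, ℂ)) : L2 G →L[ℂ] C(G, ℂ) := kernelOp (convKernel k)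

theorem conv_toL2_apply (k f : C(G, ℂ)) (x : G) :
    conv k (toL2 f) x = ∫ y, f y * k (x * y⁻¹) ∂(normalizedHaar G) := by
  refine (inner_toL2 _ f).trans ?_
  simp

/-- Left convolution commutes with right translation, which makes its eigenspaces
subrepresentations. -/
theorem conv_rightTranslate (k f : C(G, ℂ)) (g : G) :
    conv k (toL2 (rightTranslate g f)) = rightTranslate g (conv k (toL2 f)) := by
  ext x
  rw [rightTranslate_apply, conv_toL2_apply, conv_toL2_apply,
    ← integral_mul_right_eq_self (fun y => f y * k (x * g * y⁻¹)) g]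
  simp [rightTranslate_apply, mul_assoc]

theorem conv_add (k l : C(G, ℂ)) (f : L2 G) [T2Space G] : conv (k + l) f = conv k f + conv l f := by
  refine denseRange_toL2.induction_on f (isClosed_eq (by fun_prop) (by fun_prop)) fun f => ?_
  ext x
  rw [ContinuousMap.add_apply, conv_toL2_apply, conv_toL2_apply, conv_toL2_apply, ← integral_add]
  · simp [mul_add]
  · exact integrable_of_continuous (by fun_prop)
  · exact integrable_of_continuous (by fun_prop)

theorem conv_smul (c : ℂ) (k : C(G, ℂ)) (f : L2 G) [T2Space G] :
    conv (c • k) f = c • conv k f := by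
  refine denseRange_toL2.induction_on f (isClosed_eq (by fun_prop) (by fun_prop)) fun f => ?_
  ext x
  rw [ContinuousMap.smul_apply, conv_toL2_apply, conv_toL2_apply, smul_eq_mul,
    ← integral_const_mul]
  congr 1; ext y
  simp only [ContinuousMap.smul_apply, smul_eq_mul]; ring

/-- Left convolution as an operator on `L²(G)`. -/
def convOp (k : C(G, ℂ)) : L2 G →L[ℂ] L2 G := toL2.comp (conv k)

theorem convOp_apply (k : C(G, ℂ)) (f : L2 G) : convOp k f = toL2 (conv k f) := rfl

theorem isCompactOperator_convOp (k : C(G, ℂ)) : IsCompactOperator (convOp k) :=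
  (isCompactOperator_kernelOp (convKernel k)).clm_comp toL2

theorem isSymmetric_convOp [T2Space G] {k : C(G, ℂ)} (hk : ∀ g, k g⁻¹ = star (k g)) :
    (convOp k).IsSymmetric := by
  intro u v
  change ⟪convOp k u, v⟫_ℂ = ⟪u, convOp k v⟫_ℂ
  refine denseRange_toL2.induction_on₂ (isClosed_eq (by fun_prop) (by fun_prop))
    (fun u v => ?_) u v
  rw [convOp_apply, convOp_apply, inner_toL2, inner_toL2]
  simp only [conv_toL2_apply]
  have h1 : ∀ x, v x * star (∫ y, u y * k (x * y⁻¹) ∂(normalizedHaar G)) =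
      ∫ y, v x * (star (u y) * k (y * x⁻¹)) ∂(normalizedHaar G) := by
    intro x
    rw [integral_const_mul]
    congr 1
    refine integral_conj.symm.trans ?_
    congr 1; ext y
    have := hk (x * y⁻¹)
    rw [mul_inv_rev, inv_inv] at this
    rw [this]
    simp
  simp only [h1, ← integral_mul_const]
  -- This form of Fubini, for continuous functions of compact support, needs no countability
  -- assumption on G.
  rw [integral_integral_swap_of_hasCompactSupport]
  · congr 1; ext x; congr 1; ext y; ring
  · exact (by fun_prop)
  · exact HasCompactSupport.of_compactSpace _

theorem eq_zero_of_forall_conv_eq_zero [T2Space G] {f : L2 G} (h : ∀ k : C(G, ℂ), conv k f = 0) :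
    f = 0 := by
  refine ext_inner_left ℂ fun v => ?_
  rw [inner_zero_right]
  refine denseRange_toL2.induction_on v (isClosed_eq (by fun_prop) (by fun_prop)) fun v => ?_
  -- With this kernel, the value of k * f at the identity is the inner product of v with f.
  let k : C(G, ℂ) := ⟨fun g => star (v g⁻¹), by fun_prop⟩
  have h1 := DFunLike.congr_fun (h k) 1
  have h2 : convKernel k 1 = toL2 v := by
    refine congrArg toL2 ?_
    ext y
    simp [k]
  rw [← h2]
  exact h1

end L2

/-! ### Finite-dimensional translation-invariant spaces of continuous functions -/

section MatrixCoefficients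

variable {G : Type*} [Group G] [TopologicalSpace G]

/-- The matrix coefficient `π_{ij}` as a continuous function. -/
def UnitaryIrrep.coeff (π : UnitaryIrrep G) (i j : Fin π.dim) : C(G, ℂ) :=
  ⟨fun g => π.mat g i j, π.continuous_mat.matrix_elem i j⟩

theorem UnitaryIrrep.coeff_apply (π : UnitaryIrrep G) (i j : Fin π.dim) (g : G) :
    π.coeff i j g = π.mat g i j := rfl

variable (G) in
/-- The span of all matrix coefficients. -/
def coeffSpan : Submodule ℂ C(G, ℂ) :=
  Submodule.span ℂ {f | ∃ (π : UnitaryIrrep G) (i j : Fin π.dim), f = π.coeff i j}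

theorem UnitaryIrrep.coeff_mem_coeffSpan (π : UnitaryIrrep G) (i j : Fin π.dim) :
    π.coeff i j ∈ coeffSpan G :=
  Submodule.subset_span ⟨π, i, j, rfl⟩

end MatrixCoefficients

section Invariant

variable {G : Type*} [Group G] [TopologicalSpace G] [IsTopologicalGroup G] [CompactSpace G]
  [MeasurableSpace G] [BorelSpace G]

/-- A finite-dimensional space of continuous functions has a basis which is orthonormal
in `L²(G)`. -/
theorem exists_orthonormal_expansion (S : Submodule ℂ C(G, ℂ)) [FiniteDimensional ℂ S] :
    ∃ (n : ℕ) (e : Fin n → C(G, ℂ)), (∀ i, e i ∈ S) ∧ Orthonormal ℂ (fun i => toL2 (e i)) ∧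
      ∀ h ∈ S, h = ∑ i, ⟪toL2 (e i), toL2 h⟫_ℂ • e i := by
  let S' : Submodule ℂ (L2 G) := S.map toL2.toLinearMap
  let b := stdOrthonormalBasis ℂ S'
  have hb : ∀ i, ∃ f ∈ S, toL2 f = b i := fun i => (b i).2
  choose e heS he using hb
  refine ⟨_, e, heS, ?_, fun h hh => ?_⟩
  · simp only [he]
    exact b.orthonormal.comp_linearIsometry S'.subtypeₗᵢ
  -- Continuous functions that agree in L² are equal, so the expansion holds pointwise.
  · apply toL2_injective
    have h1 := congrArg Subtype.val (b.sum_repr' ⟨toL2 h, Submodule.mem_map_of_mem hh⟩)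
    simp only [map_sum, map_smul, he]
    refine h1.symm.trans ?_
    simp

/-- A space of functions is invariant under right translations. -/
def IsRightInvariant (S : Submodule ℂ C(G, ℂ)) : Prop :=
  ∀ g, ∀ f ∈ S, rightTranslate g f ∈ S

variable {S : Submodule ℂ C(G, ℂ)} {n : ℕ} {e : Fin n → C(G, ℂ)}

/-- The matrix of a right translation in an orthonormal family. -/
def translationMatrix (e : Fin n → C(G, ℂ)) (g : G) : Matrix (Fin n) (Fin n) ℂ :=
  Matrix.of fun i j => ⟪toL2 (e i), toL2 (rightTranslate g (e j))⟫_ℂ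

theorem continuous_translationMatrix (e : Fin n → C(G, ℂ)) : Continuous (translationMatrix e) :=
  continuous_matrix fun _ j =>
    continuous_const.inner (toL2.continuous.comp (continuous_rightTranslate (e j)))

theorem rightTranslate_eq_sum (hS : IsRightInvariant S) (heS : ∀ i, e i ∈ S)
    (hexp : ∀ h ∈ S, h = ∑ i, ⟪toL2 (e i), toL2 h⟫_ℂ • e i) (g : G) (j : Fin n) :
    rightTranslate g (e j) = ∑ i, translationMatrix e g i j • e i :=
  hexp _ (hS g _ (heS j))

theorem translationMatrix_one (ho : Orthonormal ℂ fun i => toL2 (e i)) :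
    translationMatrix e 1 = 1 := by
  ext i j
  simp only [translationMatrix, Matrix.of_apply, rightTranslate_one, Matrix.one_apply]
  exact orthonormal_iff_ite.mp ho i j

theorem translationMatrix_mul (hS : IsRightInvariant S) (heS : ∀ i, e i ∈ S)
    (hexp : ∀ h ∈ S, h = ∑ i, ⟪toL2 (e i), toL2 h⟫_ℂ • e i) (g h : G) :
    translationMatrix e (g * h) = translationMatrix e g * translationMatrix e h := by
  ext i j
  rw [translationMatrix, Matrix.of_apply, rightTranslate_mul,
    rightTranslate_eq_sum hS heS hexp h j, Matrix.mul_apply]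
  simp only [map_sum, map_smul, inner_sum, inner_smul_right]
  exact Finset.sum_congr rfl fun k _ => mul_comm _ _

theorem translationMatrix_mem_unitaryGroup (hS : IsRightInvariant S) (heS : ∀ i, e i ∈ S)
    (ho : Orthonormal ℂ fun i => toL2 (e i))
    (hexp : ∀ h ∈ S, h = ∑ i, ⟪toL2 (e i), toL2 h⟫_ℂ • e i) (g : G) :
    translationMatrix e g ∈ Matrix.unitaryGroup (Fin n) ℂ := by
  rw [Matrix.mem_unitaryGroup_iff']
  ext i j
  have h1 : ⟪toL2 (rightTranslate g (e i)), toL2 (rightTranslate g (e j))⟫_ℂ =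
      if i = j then 1 else 0 := by
    rw [inner_rightTranslate]
    exact orthonormal_iff_ite.mp ho i j
  rw [Matrix.one_apply, ← h1, Matrix.mul_apply]
  conv_rhs => rw [rightTranslate_eq_sum hS heS hexp g j]
  simp only [map_sum, map_smul, inner_sum, inner_smul_right]
  refine Finset.sum_congr rfl fun k _ => ?_
  rw [Matrix.star_apply, mul_comm]
  congr 1
  exact inner_conj_symm (toL2 (rightTranslate g (e i))) (toL2 (e k))

/-- The unitary matrix representation of `G` by right translations. -/
def translationHom (hS : IsRightInvariant S) (heS : ∀ i, e i ∈ S)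
    (ho : Orthonormal ℂ fun i => toL2 (e i))
    (hexp : ∀ h ∈ S, h = ∑ i, ⟪toL2 (e i), toL2 h⟫_ℂ • e i) :
    G →* Matrix.unitaryGroup (Fin n) ℂ where
  toFun g := ⟨translationMatrix e g, translationMatrix_mem_unitaryGroup hS heS ho hexp g⟩
  map_one' := Subtype.ext (translationMatrix_one ho)
  map_mul' g h := Subtype.ext (translationMatrix_mul hS heS hexp g h)

theorem rightTranslate_linearCombination (hS : IsRightInvariant S) (heS : ∀ i, e i ∈ S)
    (hexp : ∀ h ∈ S, h = ∑ i, ⟪toL2 (e i), toL2 h⟫_ℂ • e i) (g : G) (v : Fin n → ℂ) :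
    rightTranslate g (Fintype.linearCombination ℂ e v) =
      Fintype.linearCombination ℂ e (Matrix.toLin' (translationMatrix e g) v) := by
  simp only [Fintype.linearCombination_apply, map_sum, map_smul,
    rightTranslate_eq_sum hS heS hexp, Matrix.toLin'_apply, Matrix.mulVec, dotProduct,
    Finset.sum_smul, Finset.smul_sum, smul_smul]
  rw [Finset.sum_comm]
  refine Finset.sum_congr rfl fun i _ => Finset.sum_congr rfl fun j _ => ?_
  rw [mul_comm]

/-- Right translation on S is an irreducible unitary representation π in the basis e. Evaluating
e_j(xg) = ∑ π_ij(g) e_i(x) at x = 1 writes e_j as a combination of coefficients of π. -/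
theorem le_coeffSpan_of_irreducible (hS : IsRightInvariant S) [FiniteDimensional ℂ S]
    (hS0 : S ≠ ⊥) (hirr : ∀ S' ≤ S, IsRightInvariant S' → S' = ⊥ ∨ S' = S) :
    S ≤ coeffSpan G := by
  obtain ⟨n, e, heS, ho, hexp⟩ := exists_orthonormal_expansion S
  let Φ := Fintype.linearCombination ℂ e
  have hΦS : ∀ v, Φ v ∈ S := fun v => by
    rw [Fintype.linearCombination_apply]
    exact S.sum_mem fun i _ => S.smul_mem _ (heS i)
  have hli : LinearIndependent ℂ e := LinearIndependent.of_comp toL2.toLinearMap ho.linearIndependent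
  have hΦ : Function.Injective Φ := linearIndependent_iff_injective_fintypeLinearCombination.mp hli
  have hirr' : (matrixRep (translationHom hS heS ho hexp)).IsIrreducible := by
    have : Nontrivial (Subrepresentation (matrixRep (translationHom hS heS ho hexp))) := by
      refine ⟨⊥, ⊤, fun h => hS0 ?_⟩
      rw [eq_bot_iff]
      intro f hf
      have h1 : ∀ v : Fin n → ℂ, v = 0 := fun v => by
        have : v ∈ (⊤ : Subrepresentation (matrixRep (translationHom hS heS ho hexp))) :=
          Submodule.mem_top (R := ℂ)
        rw [← h] at this
        exact (Submodule.mem_bot ℂ).mp this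
      have h2 : f = Φ fun i => ⟪toL2 (e i), toL2 f⟫_ℂ := hexp f hf
      rw [h2, h1 (fun i => ⟪toL2 (e i), toL2 f⟫_ℂ), map_zero]
      exact Submodule.zero_mem _
    -- The injection Φ carries subrepresentations of ℂⁿ to invariant subspaces of S.
    refine ⟨fun U => ?_⟩
    have hU : IsRightInvariant (U.toSubmodule.map Φ) := by
      rintro g _ ⟨v, hv, rfl⟩
      rw [rightTranslate_linearCombination hS heS hexp]
      exact Submodule.mem_map_of_mem (U.apply_mem_toSubmodule g hv)
    have hle : U.toSubmodule.map Φ ≤ S := by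
      rintro _ ⟨v, -, rfl⟩
      exact hΦS v
    rcases hirr _ hle hU with h | h
    · left
      apply Subrepresentation.toSubmodule_injective
      exact Submodule.map_injective_of_injective hΦ (h.trans (Submodule.map_bot Φ).symm)
    · right
      apply Subrepresentation.toSubmodule_injective
      refine eq_top_iff.mpr fun v _ => ?_
      have h1 := hΦS v
      rw [← h] at h1
      obtain ⟨w, hw, hwv⟩ := h1
      rwa [← hΦ hwv]
  let π : UnitaryIrrep G :=
    ⟨n, translationHom hS heS ho hexp,
      (continuous_translationMatrix e).subtype_mk _, hirr'⟩
  intro f hf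
  rw [hexp f hf]
  refine Submodule.sum_mem _ fun j _ => Submodule.smul_mem _ _ ?_
  have h1 : e j = ∑ i, e i 1 • π.coeff i j := by
    ext g
    have := DFunLike.congr_fun (rightTranslate_eq_sum hS heS hexp g j) 1
    rw [rightTranslate_apply, one_mul] at this
    rw [this]
    simp only [ContinuousMap.sum_apply, ContinuousMap.smul_apply, smul_eq_mul]
    exact Finset.sum_congr rfl fun i _ => mul_comm _ _
  rw [h1]
  exact Submodule.sum_mem _ fun i _ => Submodule.smul_mem _ _ (π.coeff_mem_coeffSpan i j)

/-- The orthogonal complement of a subspace `S'` within `S`. -/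
def orthogonalIn (S S' : Submodule ℂ C(G, ℂ)) : Submodule ℂ C(G, ℂ) :=
  S ⊓ ((S'.map toL2.toLinearMap)ᗮ).comap toL2.toLinearMap

theorem mem_orthogonalIn {S S' : Submodule ℂ C(G, ℂ)} {f : C(G, ℂ)} :
    f ∈ orthogonalIn S S' ↔ f ∈ S ∧ ∀ u ∈ S', ⟪toL2 u, toL2 f⟫_ℂ = 0 := by
  simp [orthogonalIn, Submodule.mem_orthogonal]

theorem isRightInvariant_orthogonalIn {S S' : Submodule ℂ C(G, ℂ)} (hS : IsRightInvariant S)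
    (hS' : IsRightInvariant S') : IsRightInvariant (orthogonalIn S S') := by
  intro g f hf
  rw [mem_orthogonalIn] at hf ⊢
  refine ⟨hS g f hf.1, fun u hu => ?_⟩
  have h1 := hf.2 _ (hS' g⁻¹ u hu)
  rw [← inner_rightTranslate g, ← rightTranslate_mul, mul_inv_cancel, rightTranslate_one] at h1
  exact h1

theorem le_sup_orthogonalIn {S S' : Submodule ℂ C(G, ℂ)} [FiniteDimensional ℂ S'] (h : S' ≤ S) :
    S ≤ S' ⊔ orthogonalIn S S' := by
  intro f hf
  obtain ⟨u, hu, huf⟩ : (S'.map toL2.toLinearMap).starProjection (toL2 f) ∈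
    S'.map toL2.toLinearMap := Submodule.starProjection_apply_mem _ _
  refine Submodule.mem_sup.mpr ⟨u, hu, f - u, mem_orthogonalIn.mpr ⟨S.sub_mem hf (h hu), ?_⟩, by simp⟩
  intro w hw
  rw [map_sub]
  have h1 : toL2 u = (S'.map toL2.toLinearMap).starProjection (toL2 f) := huf
  rw [h1]
  exact Submodule.sub_starProjection_mem_orthogonal (K := S'.map toL2.toLinearMap) (toL2 f) _
    (Submodule.mem_map_of_mem hw)

/-- Functions generating a finite-dimensional space under translations are combinations of matrix
coefficients of irreducible unitary representations. -/
theorem le_coeffSpan (S : Submodule ℂ C(G, ℂ)) [FiniteDimensional ℂ S] (hS : IsRightInvariant S) :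
    S ≤ coeffSpan G := by
  induction hn : Module.finrank ℂ S using Nat.strong_induction_on generalizing S with
  | _ n ih =>
    subst hn
    by_cases hS0 : S = ⊥
    · rw [hS0]; exact bot_le
    by_cases hirr : ∀ S' ≤ S, IsRightInvariant S' → S' = ⊥ ∨ S' = S
    · exact le_coeffSpan_of_irreducible hS hS0 hirr
    push Not at hirr
    obtain ⟨S', hle, hS', h0, h1⟩ := hirr
    have hlt : S' < S := lt_of_le_of_ne hle h1
    have : FiniteDimensional ℂ S' := Submodule.finiteDimensional_of_le hle
    have hle2 : orthogonalIn S S' ≤ S := inf_le_left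
    have : FiniteDimensional ℂ (orthogonalIn S S') := Submodule.finiteDimensional_of_le hle2
    -- Were the complement all of S, then S' would be orthogonal to itself, hence zero.
    have hlt2 : orthogonalIn S S' < S := by
      refine lt_of_le_of_ne hle2 fun h => h0 ?_
      rw [eq_bot_iff]
      intro u hu
      have h2 : u ∈ orthogonalIn S S' := by rw [h]; exact hle hu
      have h3 := (mem_orthogonalIn.mp h2).2 u hu
      rw [inner_self_eq_zero] at h3
      exact (Submodule.mem_bot ℂ).mpr (toL2_injective (h3.trans (map_zero _).symm))
    exact (le_sup_orthogonalIn hle).trans (sup_le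
      (ih _ (Submodule.finrank_lt_finrank_of_lt hlt) S' hS' rfl)
      (ih _ (Submodule.finrank_lt_finrank_of_lt hlt2) _ (isRightInvariant_orthogonalIn hS hS') rfl))

/-! ### The Peter-Weyl theorem -/

/-- Eigenfunctions of convolution operators with nonzero eigenvalue. -/
def convEigenspace (k : C(G, ℂ)) (c : ℂ) : Submodule ℂ C(G, ℂ) :=
  Module.End.eigenspace ((conv k).comp toL2).toLinearMap c

theorem mem_convEigenspace {k : C(G, ℂ)} {c : ℂ} {f : C(G, ℂ)} :
    f ∈ convEigenspace k c ↔ conv k (toL2 f) = c • f :=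
  Module.End.mem_eigenspace_iff

theorem isRightInvariant_convEigenspace (k : C(G, ℂ)) (c : ℂ) :
    IsRightInvariant (convEigenspace k c) := by
  intro g f hf
  rw [mem_convEigenspace] at hf ⊢
  rw [conv_rightTranslate, hf, map_smul]

theorem finiteDimensional_convEigenspace (k : C(G, ℂ)) {c : ℂ} (hc : c ≠ 0) :
    FiniteDimensional ℂ (convEigenspace k c) := by
  have := ContinuousLinearMap.finite_dimensional_eigenspace (isCompactOperator_convOp k) c hc
  let φ : convEigenspace k c →ₗ[ℂ] Module.End.eigenspace (convOp k).toLinearMap c :=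
    toL2.toLinearMap.restrict fun f hf => by
      rw [mem_convEigenspace] at hf
      rw [Module.End.mem_eigenspace_iff]
      change toL2 (conv k (toL2 f)) = c • toL2 f
      rw [hf, map_smul]
  refine Module.Finite.of_injective φ fun f g h => ?_
  exact Subtype.ext (toL2_injective (congrArg Subtype.val h))

/-- An L² eigenvector with c ≠ 0 equals c⁻¹ (k * f), so it has a continuous representative lying in
a finite-dimensional invariant space. -/
theorem eigenspace_convOp_le (k : C(G, ℂ)) {c : ℂ} (hc : c ≠ 0) :
    Module.End.eigenspace (convOp k).toLinearMap c ≤ (coeffSpan G).map toL2.toLinearMap := by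
  intro f hf
  have hf' : toL2 (conv k f) = c • f := Module.End.mem_eigenspace_iff.mp hf
  have h1 : f = toL2 (c⁻¹ • conv k f) := by
    rw [map_smul, hf', smul_smul, inv_mul_cancel₀ hc, one_smul]
  have := finiteDimensional_convEigenspace k hc
  refine ⟨c⁻¹ • conv k f, le_coeffSpan _ (isRightInvariant_convEigenspace k c) ?_, h1.symm⟩
  rw [mem_convEigenspace, ← h1, smul_smul, mul_inv_cancel₀ hc, one_smul]

/-- By symmetry ⟪v, Tf⟫ = ⟪Tv, f⟫ for T = `convOp k`. This vanishes on eigenvectors v with c ≠ 0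
because f is orthogonal to v, and for c = 0 because Tv = 0. Eigenspaces of a compact symmetric
operator are total, so Tf = 0. -/
theorem conv_eq_zero_of_orthogonal [T2Space G] {f : L2 G}
    (hf : f ∈ ((coeffSpan G).map toL2.toLinearMap)ᗮ) {k : C(G, ℂ)}
    (hk : ∀ g, k g⁻¹ = star (k g)) : conv k f = 0 := by
  have hsymm := isSymmetric_convOp hk
  have h0 : convOp k f ∈
      (⨆ c, Module.End.eigenspace (convOp k : Module.End ℂ (L2 G)) c)ᗮ := by
    rw [← Submodule.iInf_orthogonal, Submodule.mem_iInf]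
    intro c
    rw [Submodule.mem_orthogonal]
    intro v hv
    have hv' : convOp k v = c • v := Module.End.mem_eigenspace_iff.mp hv
    have h1 : ⟪v, convOp k f⟫_ℂ = ⟪convOp k v, f⟫_ℂ := (hsymm v f).symm
    rw [h1, hv', inner_smul_left]
    by_cases hc : c = 0
    · simp [hc]
    · rw [hf v (eigenspace_convOp_le k hc hv), mul_zero]
  rw [ContinuousLinearMap.orthogonalComplement_iSup_eigenspaces_eq_bot
    (isCompactOperator_convOp k) hsymm, Submodule.mem_bot] at h0
  exact toL2_injective (h0.trans (map_zero _).symm)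

/-- The **Peter-Weyl theorem**: matrix coefficients are total in `L²(G)`. -/
theorem coeffSpan_orthogonal_eq_bot [T2Space G] :
    ((coeffSpan G).map toL2.toLinearMap)ᗮ = ⊥ := by
  rw [eq_bot_iff]
  intro f hf
  refine (Submodule.mem_bot ℂ).mpr (eq_zero_of_forall_conv_eq_zero fun k => ?_)
  -- Both k + k' and i(k - k') are Hermitian kernels, and together they recover 2k.
  let k' : C(G, ℂ) := ⟨fun g => star (k g⁻¹), by fun_prop⟩
  have h1 : conv (k + k') f = 0 := conv_eq_zero_of_orthogonal hf fun g => by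
    simp [k', add_comm]
  have h2 : conv (Complex.I • (k + (-1 : ℂ) • k')) f = 0 :=
    conv_eq_zero_of_orthogonal hf fun g => by
      simp [k']; ring
  rw [conv_smul, smul_eq_zero_iff_right Complex.I_ne_zero, conv_add, conv_smul] at h2
  rw [conv_add] at h1
  have h3 : (2 : ℂ) • conv k f = 0 := by
    rw [← add_zero (0 : C(G, ℂ))]
    nth_rewrite 1 [← h1]
    rw [← h2]
    module
  exact (smul_eq_zero_iff_right two_ne_zero).mp h3

end Invariant

/-! ### The Plancherel formula -/

/-- From π = M ρ N: one representative per class suffices to span all coefficients. -/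
theorem UnitaryIrrep.coeff_mem_span_of_equivalent {G : Type*} [Group G] [TopologicalSpace G]
    {π ρ : UnitaryIrrep G} (h : UnitaryIrrep.Equivalent π ρ) (i j : Fin π.dim) :
    π.coeff i j ∈
      Submodule.span ℂ (Set.range fun p : Fin ρ.dim × Fin ρ.dim => ρ.coeff p.1 p.2) := by
  obtain ⟨M, N, hMN, -, hM⟩ := h
  have h1 : π.coeff i j = ∑ l, ∑ k, (M i k * N l j) • ρ.coeff k l := by
    ext g
    have h2 : π.mat g = M * ρ.mat g * N := by
      rw [← hM, Matrix.mul_assoc, hMN, Matrix.mul_one]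
    rw [coeff_apply, h2]
    simp only [Matrix.mul_apply, Finset.sum_mul, ContinuousMap.sum_apply, ContinuousMap.smul_apply,
      coeff_apply, smul_eq_mul]
    exact Finset.sum_congr rfl fun l _ => Finset.sum_congr rfl fun k _ => by ring
  rw [h1]
  exact Submodule.sum_mem _ fun l _ => Submodule.sum_mem _ fun k _ =>
    Submodule.smul_mem _ _ (Submodule.subset_span ⟨(k, l), rfl⟩)

theorem hsNormSq_eq_zero {d : ℕ} {A : Matrix (Fin d) (Fin d) ℂ} : hsNormSq A = 0 ↔ A = 0 := by
  rw [hsNormSq_eq_sum]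
  constructor
  · intro h
    ext i j
    rw [Finset.sum_eq_zero_iff_of_nonneg fun _ _ => by positivity] at h
    have h1 := h i (Finset.mem_univ i)
    rw [Finset.sum_eq_zero_iff_of_nonneg fun _ _ => by positivity] at h1
    simpa using h1 j (Finset.mem_univ j)
  · rintro rfl
    simp

section Plancherel

variable {G : Type*} [Group G] [TopologicalSpace G] [IsTopologicalGroup G] [CompactSpace G]
  [MeasurableSpace G] [BorelSpace G] {rep : UnitaryDual G → UnitaryIrrep G}

/-- The normalized matrix coefficients `√d_π π_{ij}`, for a choice of representatives. -/
def coeffFamily (rep : UnitaryDual G → UnitaryIrrep G)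
    (p : Σ c, Fin (rep c).dim × Fin (rep c).dim) : L2 G :=
  (Real.sqrt (rep p.1).dim : ℂ) • toL2 ((rep p.1).coeff p.2.1 p.2.2)

theorem orthonormal_coeffFamily (hrep : ∀ c, (rep c).toDual = c) :
    Orthonormal ℂ (coeffFamily rep) := by
  classical
  rw [orthonormal_iff_ite]
  rintro ⟨c, i, j⟩ ⟨c', i', j'⟩
  rw [coeffFamily, coeffFamily, inner_smul_left, inner_smul_right, inner_toL2]
  simp only [UnitaryIrrep.coeff_apply]
  by_cases h : c = c'
  · subst h
    rw [UnitaryIrrep.integral_mul_star_self]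
    have hd : ((rep c).dim : ℂ) ≠ 0 := Nat.cast_ne_zero.mpr (rep c).dim_pos.ne'
    have h2 : (Real.sqrt (rep c).dim : ℂ) * (Real.sqrt (rep c).dim : ℂ) = (rep c).dim := by
      rw [← Complex.ofReal_mul, Real.mul_self_sqrt (Nat.cast_nonneg _), Complex.ofReal_natCast]
    rw [Complex.conj_ofReal, ← mul_assoc, h2, mul_ite, mul_zero, mul_inv_cancel₀ hd]
    refine if_congr ?_ rfl rfl
    simp [eq_comm]
  · rw [UnitaryIrrep.integral_mul_star_eq_zero, mul_zero, mul_zero, if_neg]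
    · simp [h]
    · intro he
      apply h
      rw [← hrep c, ← hrep c']
      exact (Quotient.sound (s := UnitaryIrrep.setoid G) he).symm

theorem span_coeffFamily_orthogonal [T2Space G] (hrep : ∀ c, (rep c).toDual = c) :
    (Submodule.span ℂ (Set.range (coeffFamily rep)))ᗮ = ⊥ := by
  rw [eq_bot_iff, ← coeffSpan_orthogonal_eq_bot]
  refine Submodule.orthogonal_le ?_
  rw [Submodule.map_le_iff_le_comap, coeffSpan, Submodule.span_le]
  rintro _ ⟨π, i, j, rfl⟩
  have h1 : UnitaryIrrep.Equivalent π (rep π.toDual) :=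
    Quotient.exact (s := UnitaryIrrep.setoid G) (hrep π.toDual).symm
  refine (Submodule.span_le.mpr ?_) (π.coeff_mem_span_of_equivalent h1 i j)
  rintro _ ⟨⟨k, l⟩, rfl⟩
  have hd : (Real.sqrt (rep π.toDual).dim : ℂ) ≠ 0 :=
    Complex.ofReal_ne_zero.mpr (Real.sqrt_pos.mpr (Nat.cast_pos.mpr (rep _).dim_pos)).ne'
  have h2 : toL2 ((rep π.toDual).coeff k l) =
      (Real.sqrt (rep π.toDual).dim : ℂ)⁻¹ • coeffFamily rep ⟨π.toDual, k, l⟩ := by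
    rw [coeffFamily, smul_smul, inv_mul_cancel₀ hd, one_smul]
  change toL2 ((rep π.toDual).coeff k l) ∈ Submodule.span ℂ (Set.range (coeffFamily rep))
  rw [h2]
  exact Submodule.smul_mem _ _ (Submodule.subset_span ⟨_, rfl⟩)

/-- The adjoint in the definition of f̂ transposes the indices. -/
theorem inner_coeffFamily (f : C(G, ℂ)) (p : Σ c, Fin (rep c).dim × Fin (rep c).dim) :
    ⟪coeffFamily rep p, toL2 f⟫_ℂ =
      Real.sqrt (rep p.1).dim * groupFourierCoeff f (rep p.1) p.2.2 p.2.1 := by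
  rw [coeffFamily, inner_smul_left, inner_toL2, Complex.conj_ofReal]
  rfl

/-- The **Plancherel formula** for continuous functions on a compact group. -/
theorem hasSum_plancherel [T2Space G] (hrep : ∀ c, (rep c).toDual = c) (f : C(G, ℂ)) :
    HasSum (fun c => ((rep c).dim : ℝ) * hsNormSq (groupFourierCoeff f (rep c)))
      (∫ x, ‖f x‖ ^ 2 ∂(normalizedHaar G)) := by
  let b := HilbertBasis.mkOfOrthogonalEqBot (orthonormal_coeffFamily hrep)
    (span_coeffFamily_orthogonal hrep)
  have hb : ∀ p, b p = coeffFamily rep p := fun p =>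
    congrFun (HilbertBasis.coe_mkOfOrthogonalEqBot _ _) p
  have h1 := b.hasSum_inner_mul_inner (toL2 f) (toL2 f)
  have h2 : ⟪toL2 f, toL2 f⟫_ℂ = ((∫ x, ‖f x‖ ^ 2 ∂(normalizedHaar G) : ℝ) : ℂ) := by
    rw [inner_toL2, ← integral_complex_ofReal]
    congr 1; ext x
    rw [Complex.ofReal_pow]
    exact Complex.mul_conj' _
  have h3 : ∀ p : Σ c, Fin (rep c).dim × Fin (rep c).dim,
      ⟪toL2 f, b p⟫_ℂ * ⟪b p, toL2 f⟫_ℂ =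
        (((rep p.1).dim * ‖groupFourierCoeff f (rep p.1) p.2.2 p.2.1‖ ^ 2 : ℝ) : ℂ) := by
    intro p
    rw [← inner_conj_symm, Complex.conj_mul', hb, inner_coeffFamily, norm_mul,
      Complex.norm_real, Real.norm_of_nonneg (Real.sqrt_nonneg _), ← Complex.ofReal_pow, mul_pow,
      Real.sq_sqrt (Nat.cast_nonneg _)]
  simp only [h2, h3] at h1
  -- Group the Parseval sum by class; each class contributes a finite block of d_π² terms.
  have h4 := (Complex.hasSum_ofReal.mp h1).sigma fun c => hasSum_fintype _
  convert h4 using 2 with c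
  rw [hsNormSq_eq_sum, Fintype.sum_prod_type, Finset.sum_comm, Finset.mul_sum]
  exact Finset.sum_congr rfl fun i _ => Finset.mul_sum _ _ _

end Plancherel

/-! ### The averaged projection -/

section AvgProj

variable {G : Type*} [Group G] [TopologicalSpace G] [IsTopologicalGroup G] [CompactSpace G]
  [MeasurableSpace G] [BorelSpace G] (H : Subgroup G) [hH : IsClosed (H : Set G)]

theorem avgProj_eq_matInt (π : UnitaryIrrep G) :
    avgProj H π = matInt (normalizedHaar H) fun h : H => π.mat (h : G) := rfl

/-- Each π(h)^* = π(h⁻¹) fixes π_H by left invariance; average over h. This one identity yields both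
self-adjointness and idempotence. -/
theorem conjTranspose_avgProj_mul_self (π : UnitaryIrrep G) :
    (avgProj H π).conjTranspose * avgProj H π = avgProj H π := by
  have hπ := π.continuous_mat
  have hc : Continuous fun h : H => π.mat (h : G) := by fun_prop
  have h1 : ∀ h : H, (π.mat (h : G)).conjTranspose * avgProj H π = avgProj H π := by
    intro h
    rw [avgProj_eq_matInt, mul_matInt _ hc, ← π.mat_inv]
    simp only [← π.mat_mul]
    exact matInt_mul_left_eq_self (fun h : H => π.mat (h : G)) h⁻¹
  have h2 : (avgProj H π).conjTranspose =
      matInt (normalizedHaar H) fun h : H => (π.mat (h : G)).conjTranspose :=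
    conjTranspose_matInt _
  rw [h2, matInt_mul (by fun_prop)]
  simp only [h1, matInt_const]

theorem conjTranspose_avgProj (π : UnitaryIrrep G) :
    (avgProj H π).conjTranspose = avgProj H π := by
  rw [← conjTranspose_avgProj_mul_self, Matrix.conjTranspose_mul,
    Matrix.conjTranspose_conjTranspose, conjTranspose_avgProj_mul_self]

theorem trace_avgProj (π : UnitaryIrrep G) : (avgProj H π).trace = (avgProj H π).rank := by
  refine trace_eq_rank_of_mul_self ?_
  have := conjTranspose_avgProj_mul_self H π
  rwa [conjTranspose_avgProj] at this

/-- The integrand is tr(A^* π(y) π_H π(y)^* A), and the average of the middle factor is the scalar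
rank(π_H)/d_π. -/
theorem integral_hsNormSq_avgProj_mul (π : UnitaryIrrep G) (A : Matrix (Fin π.dim) (Fin π.dim) ℂ) :
    ∫ y, hsNormSq (avgProj H π * (π.mat y).conjTranspose * A) ∂(normalizedHaar G) =
      (avgProj H π).rank / π.dim * hsNormSq A := by
  have hπ := π.continuous_mat
  rw [← Complex.ofReal_inj, ← integral_complex_ofReal]
  push_cast
  simp only [ofReal_hsNormSq]
  have h1 : ∀ y, (avgProj H π * (π.mat y).conjTranspose * A).conjTranspose *
      (avgProj H π * (π.mat y).conjTranspose * A) =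
      A.conjTranspose * (π.mat y * avgProj H π * (π.mat y).conjTranspose) * A := by
    intro y
    conv_rhs => rw [← conjTranspose_avgProj_mul_self]
    simp only [Matrix.conjTranspose_mul, Matrix.conjTranspose_conjTranspose, Matrix.mul_assoc]
  simp only [h1]
  rw [← trace_matInt (by fun_prop), ← matInt_mul (by fun_prop), ← mul_matInt _ (by fun_prop),
    UnitaryIrrep.average_eq_smul_one, trace_avgProj]
  simp [Matrix.trace_smul]

theorem rank_avgProj_eq_zero {rep : UnitaryDual G → UnitaryIrrep G}
    (hrep : ∀ c, (rep c).toDual = c) {c : UnitaryDual G} (hc : c ∉ classOneDual H) :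
    (avgProj H (rep c)).rank = 0 := by
  by_contra h
  exact hc ⟨rep c, hrep c, Nat.one_le_iff_ne_zero.mpr h⟩

end AvgProj

/-! ### Fourier coefficients of the Radon transform -/

section Radon

variable {G : Type*} [Group G] [TopologicalSpace G] [IsTopologicalGroup G] [CompactSpace G]
  [MeasurableSpace G] [BorelSpace G] (H : Subgroup G) [hH : IsClosed (H : Set G)]

theorem continuous_radonPre [FirstCountableTopology G] (f : C(G, ℂ)) :
    Continuous fun p : G × G => radonPre H f p.1 p.2 := by
  have h1 := continuous_parametric_integral_of_continuous (μ := normalizedHaar H)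
    (f := fun (p : G × G) (h : H) => f (p.1 * (h : G) * p.2⁻¹)) (by fun_prop) isCompact_univ
  simpa only [Measure.restrict_univ] using! h1

theorem matInt_smul_conjTranspose (f : C(G, ℂ)) (π : UnitaryIrrep G) (y h : G) :
    matInt (normalizedHaar G) (fun x => f (x * h * y⁻¹) • (π.mat x).conjTranspose) =
      π.mat h * ((π.mat y).conjTranspose * groupFourierCoeff f π) := by
  have hπ := π.continuous_mat
  have h1 : groupFourierCoeff f π =
      matInt (normalizedHaar G) fun x => f x • (π.mat x).conjTranspose := rfl
  rw [← Matrix.mul_assoc, h1, mul_matInt _ (by fun_prop),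
    -- The substitution x ↦ x y h⁻¹ reduces the argument of f to x, and π(x y h⁻¹)^* = π(h) π(y)^*
    -- π(x)^*.
    ← matInt_mul_right_eq_self (fun x => f (x * h * y⁻¹) • (π.mat x).conjTranspose) (y * h⁻¹)]
  congr 1
  funext x
  rw [Matrix.mul_smul, ← π.mat_inv, ← π.mat_inv, ← π.mat_inv, ← π.mat_mul, ← π.mat_mul]
  congr 2 <;> group

theorem groupFourierCoeff_radonPre (f : C(G, ℂ)) (π : UnitaryIrrep G) (y : G) :
    groupFourierCoeff (fun x => radonPre H f x y) π =
      avgProj H π * (π.mat y).conjTranspose * groupFourierCoeff f π := by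
  have hπ := π.continuous_mat
  rw [Matrix.mul_assoc, avgProj_eq_matInt, matInt_mul (by fun_prop)]
  simp only [← matInt_smul_conjTranspose]
  ext i j
  simp only [groupFourierCoeff, radonPre, matInt, Matrix.of_apply, ← integral_mul_const]
  rw [integral_integral_swap_of_hasCompactSupport]
  · rfl
  · have := (hπ.matrix_conjTranspose).matrix_elem i j
    have h2 : Continuous fun x => f x := f.continuous
    exact (h2.comp (by fun_prop)).mul (this.comp continuous_fst)
  · exact HasCompactSupport.of_compactSpace _

theorem hasSum_integral_integral_radonPre [T2Space G] [FirstCountableTopology G]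
    {rep : UnitaryDual G → UnitaryIrrep G} (hrep : ∀ c, (rep c).toDual = c) (f : C(G, ℂ)) :
    HasSum (fun c => ((avgProj H (rep c)).rank : ℝ) * hsNormSq (groupFourierCoeff f (rep c)))
      (∫ y, ∫ x, ‖radonPre H f x y‖ ^ 2 ∂(normalizedHaar G) ∂(normalizedHaar G)) := by
  have hf := (hasSum_plancherel hrep f).summable
  let F : UnitaryDual G → G → ℝ := fun c y => (rep c).dim *
    hsNormSq (avgProj H (rep c) * ((rep c).mat y).conjTranspose * groupFourierCoeff f (rep c))
  have hF : ∀ y, HasSum (F · y) (∫ x, ‖radonPre H f x y‖ ^ 2 ∂(normalizedHaar G)) := by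
    intro y
    have h1 := hasSum_plancherel hrep ⟨fun x => radonPre H f x y,
      (continuous_radonPre H f).comp (by fun_prop : Continuous fun x : G => (x, y))⟩
    simp only [ContinuousMap.coe_mk, groupFourierCoeff_radonPre] at h1
    exact h1
  have hFnonneg : ∀ c y, 0 ≤ F c y := fun c y => mul_nonneg (Nat.cast_nonneg _) (hsNormSq_nonneg _)
  have hFcont : ∀ c, Continuous (F c) := fun c => by
    have := (rep c).continuous_mat
    refine continuous_const.mul (Complex.continuous_re.comp ?_)
    fun_prop
  have hFint : ∀ c, ∫ y, F c y ∂(normalizedHaar G) =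
      (avgProj H (rep c)).rank * hsNormSq (groupFourierCoeff f (rep c)) := fun c => by
    have hd : ((rep c).dim : ℝ) ≠ 0 := Nat.cast_ne_zero.mpr (rep c).dim_pos.ne'
    rw [integral_const_mul, integral_hsNormSq_avgProj_mul]
    field_simp
  -- Termwise integration needs a countable index set; a summable family has countable support, and
  -- off s every term vanishes.
  let s := Function.support fun c => ((rep c).dim : ℝ) * hsNormSq (groupFourierCoeff f (rep c))
  have hs : ∀ c ∉ s, groupFourierCoeff f (rep c) = 0 := fun c hc => by
    have hd : ((rep c).dim : ℝ) ≠ 0 := Nat.cast_ne_zero.mpr (rep c).dim_pos.ne'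
    rw [← hsNormSq_eq_zero]
    exact (mul_eq_zero.mp (Function.notMem_support.mp hc)).resolve_left hd
  have : Countable s := hf.countable_support.to_subtype
  -- Since rank(π_H) ≤ d_π, the Plancherel series of f dominates.
  have hsum : Summable fun c =>
      ((avgProj H (rep c)).rank : ℝ) * hsNormSq (groupFourierCoeff f (rep c)) :=
    hf.of_nonneg_of_le (fun c => mul_nonneg (Nat.cast_nonneg _) (hsNormSq_nonneg _)) fun c =>
      mul_le_mul_of_nonneg_right
        (Nat.cast_le.mpr (((avgProj H (rep c)).rank_le_card_width).trans_eq (Fintype.card_fin _)))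
        (hsNormSq_nonneg _)
  have h1 := hasSum_integral_of_summable_integral_norm (μ := normalizedHaar G)
    (F := fun c : s => F c) (fun c => integrable_of_continuous (hFcont c)) (by
      simp only [Real.norm_of_nonneg (hFnonneg _ _), hFint]
      exact hsum.subtype s)
  simp only [hFint] at h1
  have h2 : ∀ y, ∑' c : s, F c y = ∫ x, ‖radonPre H f x y‖ ^ 2 ∂(normalizedHaar G) := fun y =>
    ((hasSum_subtype_iff_of_support_subset fun c hc => by
      by_contra h
      exact hc (by simp [F, hs c h, hsNormSq])).mpr (hF y)).tsum_eq
  simp only [h2] at h1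
  refine (hasSum_subtype_iff_of_support_subset fun c hc => ?_).mp h1
  by_contra h
  exact hc (by simp [hs c h, hsNormSq])

end Radon

/-! ### The Radon transform on `G/H × G/H` -/

section Quotient

variable {G : Type*} [Group G] [TopologicalSpace G] [IsTopologicalGroup G] [CompactSpace G]
  [MeasurableSpace G] [BorelSpace G] (H : Subgroup G)

instance : IsProbabilityMeasure (quotientHaar H) :=
  Measure.isProbabilityMeasure_map QuotientGroup.measurable_coe.aemeasurable

theorem quotientHaar_prod : (quotientHaar H).prod (quotientHaar H) =
    Measure.map (Prod.map (QuotientGroup.mk : G → G ⧸ H) (QuotientGroup.mk : G → G ⧸ H))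
      ((normalizedHaar G).prod (normalizedHaar G)) :=
  Measure.map_prod_map _ _ QuotientGroup.measurable_coe QuotientGroup.measurable_coe

variable [hH : IsClosed (H : Set G)]

theorem continuous_radon [FirstCountableTopology G] (f : C(G, ℂ)) : Continuous (radon H f) := by
  have hq : Topology.IsQuotientMap
      (Prod.map (QuotientGroup.mk : G → G ⧸ H) (QuotientGroup.mk : G → G ⧸ H)) :=
    (QuotientGroup.isOpenQuotientMap_mk.prodMap QuotientGroup.isOpenQuotientMap_mk).isQuotientMap
  rw [hq.continuous_iff]
  exact continuous_radonPre H f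

theorem memLp_radon [T2Space G] [SecondCountableTopology G] (f : C(G, ℂ)) :
    MemLp (radon H f) 2 ((quotientHaar H).prod (quotientHaar H)) := by
  -- For G Polish and H closed, the quotient σ-algebra on G/H is the Borel one, so the continuous
  -- function Rf is measurable.
  have : PolishSpace G := by
    let _ := TopologicalSpace.metrizableSpaceMetric G
    infer_instance
  have : BorelSpace (G ⧸ H) := inferInstance
  have hc := continuous_radon H f
  obtain ⟨C, hC⟩ := isCompact_univ.exists_bound_of_continuousOn hc.continuousOn
  exact MemLp.of_bound hc.aestronglyMeasurable C (ae_of_all _ fun p => hC p (Set.mem_univ p))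

theorem eLpNorm_radon_sq [T2Space G] [SecondCountableTopology G] (f : C(G, ℂ)) :
    (eLpNorm (radon H f) 2 ((quotientHaar H).prod (quotientHaar H))).toReal ^ 2 =
      ∫ y, ∫ x, ‖radonPre H f x y‖ ^ 2 ∂(normalizedHaar G) ∂(normalizedHaar G) := by
  have hm := memLp_radon H f
  have hc := continuous_radonPre H f
  have h1 : (eLpNorm (radon H f) 2 ((quotientHaar H).prod (quotientHaar H))).toReal ^ 2 =
      ∫ p, ‖radon H f p‖ ^ 2 ∂((quotientHaar H).prod (quotientHaar H)) := by
    have h0 : 0 ≤ ∫ p, ‖radon H f p‖ ^ 2 ∂((quotientHaar H).prod (quotientHaar H)) :=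
      integral_nonneg fun p => by positivity
    rw [hm.eLpNorm_eq_integral_rpow_norm two_ne_zero ENNReal.ofNat_ne_top]
    simp only [ENNReal.toReal_ofNat, Real.rpow_ofNat]
    rw [ENNReal.toReal_ofReal (by positivity), ← Real.rpow_natCast, ← Real.rpow_mul h0]
    norm_num
  rw [h1, quotientHaar_prod, integral_map]
  · refine Eq.trans ?_ (integral_prod_symm (fun p : G × G => ‖radonPre H f p.1 p.2‖ ^ 2) ?_)
    · rfl
    · exact integrable_of_continuous (by fun_prop)
  · exact (QuotientGroup.measurable_coe.prodMap QuotientGroup.measurable_coe).aemeasurable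
  · rw [← quotientHaar_prod]
    exact (hm.1.norm.pow 2)

end Quotient

end

end CompactRadon

theorem mainTheorem7
    {E : Type*} [NormedAddCommGroup E] [NormedSpace ℝ E] [FiniteDimensional ℝ E]
    {M : Type*} [TopologicalSpace M] (I : ModelWithCorners ℝ E M) [I.Boundaryless]
    {G : Type*} [Group G] [TopologicalSpace G] [ChartedSpace M G] [LieGroup I ∞ G]
    [IsTopologicalGroup G] [T2Space G] [CompactSpace G] [MeasurableSpace G] [BorelSpace G]
    (H : Subgroup G) [hH : IsClosed (H : Set G)]
    (f : G → ℂ) (hf : ContMDiff I 𝓘(ℝ, ℂ) ∞ f)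
    (rep : CompactRadon.UnitaryDual G → CompactRadon.UnitaryIrrep G)
    (hrep : ∀ c, (rep c).toDual = c) :
    MemLp (CompactRadon.radon H f) 2
        ((CompactRadon.quotientHaar H).prod (CompactRadon.quotientHaar H)) ∧
      HasSum
        (fun c : CompactRadon.classOneDual H =>
          ((CompactRadon.avgProj H (rep c)).rank : ℝ) *
            CompactRadon.hsNormSq (CompactRadon.groupFourierCoeff f (rep c)))
        ((eLpNorm (CompactRadon.radon H f) 2
          ((CompactRadon.quotientHaar H).prod (CompactRadon.quotientHaar H))).toReal ^ 2) := by
  -- A compact manifold modelled on a finite-dimensional space is second countable.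
  have : SecondCountableTopology M := I.secondCountableTopology
  have : SecondCountableTopology G := ChartedSpace.secondCountable_of_sigmaCompact M G
  let F : C(G, ℂ) := ⟨f, hf.continuous⟩
  refine ⟨CompactRadon.memLp_radon H F, ?_⟩
  have h := CompactRadon.hasSum_integral_integral_radonPre H hrep F
  rw [← CompactRadon.eLpNorm_radon_sq H F] at h
  -- Classes outside Ĝ₁ have rank(π_H) = 0, so restricting the sum to Ĝ₁ loses nothing.
  refine (hasSum_subtype_iff_of_support_subset fun c hc => ?_).mpr h
  by_contra hc'
  exact hc (by simp [CompactRadon.rank_avgProj_eq_zero H hrep hc'])
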